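/- Let $\varrho$ be the substitution $0\mapsto 02$, $1\mapsto 32$, $2\mapsto 01$, $3\mapsto 31$. Let $u=(u_i)_{i\in\mathbb{Z}}$ be a bi-infinite quaternary Rudin--Shapiro sequence, that is, a fixed point of $\varrho^2$ with one of the legal seeds $u_{-1}|u_0\in\{2|0,\,2|3,\,1|0,\,1|3\}$, and let $w=(w_i)_{i\in\mathbb{Z}}$ be the associated binary Rudin--Shapiro sequence with balanced weights: $w_i=1$ if $u_i\in\{0,2\}$ and $w_i=-1$ if $u_i\in\{1,3\}$. For $(m_1,m_2,m_3)\in\mathbb{Z}^3$ put $$\eta^{(4)}(m_1,m_2,m_3)=\lim_{N\to\infty}\frac{1}{2N+1}\sum_{i=-N}^{N}w_i\,w_{i+m_1}w_{i+m_2}w_{i+m_3},$$ $$\theta^{(4)}(m_1,m_2,m_3)=\lim_{N\to\infty}\frac{1}{2N+1}\sum_{i=-N}^{N}(-1)^i\,w_i\,w_{i+m_1}w_{i+m_2}w_{i+m_3}.$$ **Proposition (starting vector $(1,\ell,\ell+2)$).** For all $\ell\in\mathbb{Z}$ and all integers $m\ge 0$, $n\ge 1$, the following limits exist and have the values $$\eta^{(4)}\bigl(2^m(1,\,2^n(2\ell+1),\,2^n(2\ell+1)+2)\bigr)=\begin{cases}0,&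 m=0,\ n=1,\\ \frac14,& m=0,\ n=2,\\ -\frac{3}{2^n},& m=0,\ n\ge 3,\\ 0,& m\ge 1,\end{cases}$$ $$\theta^{(4)}\bigl(2^m(1,\,2^n(2\ell+1),\,2^n(2\ell+1)+2)\bigr)=\begin{cases}0,& m\in\{0,1\},\ n=1,\\ -(-1)^m\frac14,& m\in\{0,1\},\ n=2,\\ (-1)^m\frac{3}{2^n},& m\in\{0,1\},\ n\ge 3,\\ 0,& m\ge 2,\end{cases}$$ $$\eta^{(4)}\bigl(2^m(1,\,2^n(2\ell+1)-1,\,2^n(2\ell+1)+1)\bigr)=\begin{cases}0,& m=0,\ n=1,\\ -\frac14,& m=0,\ n=2,\\ \frac{3}{2^n},& m=0,\ n\ge 3,\\ 0,& m\ge 1,\end{cases}$$ $$\theta^{(4)}\bigl(2^m(1,\,2^n(2\ell+1)-1,\,2^n(2\ell+1)+1)\bigr)=\begin{cases}0,& m\in\{0,1\},\ n=1,\\ (-1)^m\frac14,& m\in\{0,1\},\ n=2,\\ -(-1)^m\frac{3}{2^n},& m\in\{0,1\},\ n\ge 3,\\ 0,& m\ge 2.\end{cases}$$ -/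

import Mathlib

/-- The quaternary Rudin–Shapiro substitution
`0 ↦ 02`, `1 ↦ 32`, `2 ↦ 01`, `3 ↦ 31`. -/
def rsSubst : Fin 4 → Fin 4 × Fin 4 :=
  ![(0, 2), (3, 2), (0, 1), (3, 1)]

/-- The action of the substitution on a bi-infinite word: the letter `u j` is replaced by the
two letters of `rsSubst (u j)`, which occupy the positions `2 * j` and `2 * j + 1`
(`i / 2` is the floor of half of `i`). -/
def rsSubstWord (u : ℤ → Fin 4) (i : ℤ) : Fin 4 :=
  if Even i then (rsSubst (u (i / 2))).1 else (rsSubst (u (i / 2))).2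

/-- `u` is a bi-infinite quaternary Rudin–Shapiro sequence: a fixed point of the square of the
substitution, with one of the legal seeds `2|0`, `2|3`, `1|0`, `1|3` at the positions `-1|0`. -/
structure IsQuaternaryRS (u : ℤ → Fin 4) : Prop where
  fixed : rsSubstWord (rsSubstWord u) = u
  seed_left : u (-1) = 2 ∨ u (-1) = 1
  seed_right : u 0 = 0 ∨ u 0 = 3

/-- The letter map `0, 2 ↦ a` and `1, 3 ↦ b` with the balanced weights `a = 1`, `b = -1`. -/
def rsWeight : Fin 4 → ℝ := ![1, -1, 1, -1]

/-- `w` is a bi-infinite binary Rudin–Shapiro sequence with balanced weights. -/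
def IsBinaryRS (w : ℤ → ℝ) : Prop :=
  ∃ u : ℤ → Fin 4, IsQuaternaryRS u ∧ ∀ i, w i = rsWeight (u i)

/-- The average of `w i * w (i + m₁) * ⋯ * w (i + mₖ)` over `-N ≤ i ≤ N`. -/
noncomputable def etaAverage (w : ℤ → ℝ) {k : ℕ} (m : Fin k → ℤ) (N : ℕ) : ℝ :=
  1 / (2 * (N : ℝ) + 1) * ∑ i ∈ Finset.Icc (-(N : ℤ)) (N : ℤ), w i * ∏ j, w (i + m j)

/-- The average of `(-1) ^ i * w i * w (i + m₁) * ⋯ * w (i + mₖ)` over `-N ≤ i ≤ N`. -/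
noncomputable def thetaAverage (w : ℤ → ℝ) {k : ℕ} (m : Fin k → ℤ) (N : ℕ) : ℝ :=
  1 / (2 * (N : ℝ) + 1) *
    ∑ i ∈ Finset.Icc (-(N : ℤ)) (N : ℤ), (-1 : ℝ) ^ i * (w i * ∏ j, w (i + m j))

/-- The `(k+1)`-point correlation `η(m₁, …, mₖ)` of `w` exists (as a limit of averages) and is
equal to `c`. -/
def HasEta (w : ℤ → ℝ) {k : ℕ} (m : Fin k → ℤ) (c : ℝ) : Prop :=
  Filter.Tendsto (etaAverage w m) Filter.atTop (nhds c)

/-- The signed `(k+1)`-point correlation `θ(m₁, …, mₖ)` of `w` exists (as a limit of averages)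
and is equal to `c`. -/
def HasTheta (w : ℤ → ℝ) {k : ℕ} (m : Fin k → ℤ) (c : ℝ) : Prop :=
  Filter.Tendsto (thetaAverage w m) Filter.atTop (nhds c)

/-! Let `v` be the weight sequence of the substituted word. Then `w (2i) = v i` and `w (2i+1) =
(-1)^i v i`, and the same holds with `w` and `v` exchanged, since the squared substitution fixes the
word. Splitting a mean into even and odd positions (`HasMean.of_halves`) thus expresses correlations
of one sequence by those of the other; results are proved for all such pairs, so inductions may swap
the two.

Write e and t for η and θ at `(1, K, K + 1)`. Both vanish for odd `K`. For `K = 2J`, e = ±(1 + e')/2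
and t = ±(1 - e')/2, with e' taken at `J` and ± the parity sign of `J`; hence e = 1 - 3/2^k at `K =
2^k(2l+1)`, k ≥ 1 (`hasMean_fourProd_two_pow`). One more splitting sends t to ±t/2 at the two
starting vectors. Doubling a vector with odd coordinate sum kills η and moves the old η into θ; the
next doubling kills both (`hasMean_fourProd_two_pow_mul`). -/

/-! ### Symmetric means of bi-infinite sequences -/

/-- The sum of `f` over `-N ≤ i ≤ N`. -/
noncomputable def symmSum (f : ℤ → ℝ) (N : ℕ) : ℝ :=
  ∑ i ∈ Finset.Icc (-(N : ℤ)) (N : ℤ), f i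

/-- The symmetric averages of `f` converge to `c`. -/
def HasMean (f : ℤ → ℝ) (c : ℝ) : Prop :=
  Filter.Tendsto (fun N : ℕ => 1 / (2 * (N : ℝ) + 1) * symmSum f N) Filter.atTop (nhds c)

theorem symmSum_zero (f : ℤ → ℝ) : symmSum f 0 = f 0 := by
  simp [symmSum]

theorem symmSum_succ (f : ℤ → ℝ) (N : ℕ) :
    symmSum f (N + 1) = symmSum f N + f (N + 1) + f (-(N + 1)) := by
  have h : Finset.Icc (-((N + 1 : ℕ) : ℤ)) ((N + 1 : ℕ) : ℤ) =
      insert ((N : ℤ) + 1) (insert (-((N : ℤ) + 1)) (Finset.Icc (-(N : ℤ)) (N : ℤ))) := by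
    ext x
    simp only [Finset.mem_insert, Finset.mem_Icc]
    push_cast
    omega
  unfold symmSum
  rw [h, Finset.sum_insert, Finset.sum_insert]
  · ring
  · simp only [Finset.mem_Icc]
    omega
  · simp only [Finset.mem_insert, Finset.mem_Icc]
    omega

theorem symmSum_two_mul (f : ℤ → ℝ) (M : ℕ) :
    symmSum f (2 * M) =
      symmSum (fun i => f (2 * i)) M + symmSum (fun i => f (2 * i + 1)) M - f (2 * M + 1) := by
  induction M with
  | zero => simp [symmSum_zero]
  | succ M ih =>
    have h : 2 * (M + 1) = 2 * M + 1 + 1 := by ring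
    rw [h, symmSum_succ, symmSum_succ, symmSum_succ, symmSum_succ, ih]
    push_cast
    have h1 : (2 * (M : ℤ) + 1 + 1) = 2 * (M + 1) := by ring
    have h2 : (2 * (-((M : ℤ) + 1)) + 1) = -(2 * M + 1) := by ring
    have h3 : (2 * (-((M : ℤ) + 1))) = -(2 * (M + 1)) := by ring
    rw [h1, h2, h3]
    ring

/-- Halving the window `[-N, N]` misplaces only one boundary term: `2M + 1` is in excess for `N =
2M`, and `-(2M + 1)` is left over for `N = 2M + 1`. -/
theorem abs_symmSum_sub_le {f : ℤ → ℝ} (hf : ∀ i, |f i| ≤ 1) (N : ℕ) :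
    |symmSum f N -
      (symmSum (fun i => f (2 * i)) (N / 2) + symmSum (fun i => f (2 * i + 1)) (N / 2))| ≤ 1 := by
  rcases Nat.even_or_odd' N with ⟨M, rfl | rfl⟩
  · have h : 2 * M / 2 = M := by omega
    rw [h, symmSum_two_mul]
    simpa using hf (2 * M + 1)
  · have h : (2 * M + 1) / 2 = M := by omega
    rw [h, symmSum_succ, symmSum_two_mul]
    push_cast
    convert hf (-(2 * M + 1)) using 2
    ring

theorem tendsto_inv_two_mul_add_one :
    Filter.Tendsto (fun N : ℕ => 1 / (2 * (N : ℝ) + 1)) Filter.atTop (nhds 0) := by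
  have h : Filter.Tendsto (fun N : ℕ => 2 * (N : ℝ) + 1) Filter.atTop Filter.atTop :=
    Filter.tendsto_atTop_add_const_right _ _
      (tendsto_natCast_atTop_atTop.const_mul_atTop two_pos)
  refine h.inv_tendsto_atTop.congr fun N => ?_
  simp

theorem tendsto_inv_mul_of_abs_le {x : ℕ → ℝ} {C : ℝ} (hx : ∀ N, |x N| ≤ C) :
    Filter.Tendsto (fun N : ℕ => 1 / (2 * (N : ℝ) + 1) * x N) Filter.atTop (nhds 0) := by
  have h := tendsto_inv_two_mul_add_one.mul_const C
  rw [zero_mul] at h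
  refine squeeze_zero_norm (fun N => ?_) h
  have hN : (0 : ℝ) < 1 / (2 * (N : ℝ) + 1) := by positivity
  rw [Real.norm_eq_abs, abs_mul, abs_of_pos hN]
  exact mul_le_mul_of_nonneg_left (hx N) hN.le

theorem HasMean.const_mul {f : ℤ → ℝ} {c : ℝ} (hf : HasMean f c) (a : ℝ) :
    HasMean (fun i => a * f i) (a * c) := by
  unfold HasMean at *
  convert Filter.Tendsto.const_mul a hf using 2 with N
  unfold symmSum
  rw [← Finset.mul_sum]
  ring

theorem hasMean_const (a : ℝ) : HasMean (fun _ => a) a := by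
  unfold HasMean
  refine tendsto_const_nhds.congr fun N => ?_
  have hN : (2 * (N : ℝ) + 1) ≠ 0 := by positivity
  have h : (((N : ℤ) + 1 + N).toNat : ℝ) = 2 * N + 1 := by
    have : ((N : ℤ) + 1 + N).toNat = 2 * N + 1 := by omega
    rw [this]
    push_cast
    ring
  simp only [symmSum, Finset.sum_const, Int.card_Icc, sub_neg_eq_add, nsmul_eq_mul, h]
  field_simp

theorem HasMean.of_halves {f : ℤ → ℝ} {a b : ℝ} (hf : ∀ i, |f i| ≤ 1)
    (h0 : HasMean (fun i => f (2 * i)) a) (h1 : HasMean (fun i => f (2 * i + 1)) b) :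
    HasMean f ((a + b) / 2) := by
  have hhalf : Filter.Tendsto (fun N : ℕ => N / 2) Filter.atTop Filter.atTop :=
    Nat.tendsto_div_const_atTop two_ne_zero
  have hab := (h0.add h1).comp hhalf
  have hratio : Filter.Tendsto
      (fun N : ℕ => (2 * ((N / 2 : ℕ) : ℝ) + 1) / (2 * (N : ℝ) + 1)) Filter.atTop
      (nhds (1 / 2)) := by
    have herr : ∀ N : ℕ, |2 * ((N / 2 : ℕ) : ℝ) + 1 - (N + 1 / 2)| ≤ 1 := fun N => by
      have h := Nat.div_add_mod N 2
      have h' : (2 : ℝ) * (N / 2 : ℕ) + (N % 2 : ℕ) = N := by exact_mod_cast h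
      have hlt : ((N % 2 : ℕ) : ℝ) ≤ 1 := by
        exact_mod_cast Nat.lt_succ_iff.mp (Nat.mod_lt N two_pos)
      have hge : (0 : ℝ) ≤ (N % 2 : ℕ) := Nat.cast_nonneg _
      rw [abs_le]
      constructor <;> linarith
    have h := (tendsto_inv_mul_of_abs_le herr).add_const (1 / 2)
    rw [zero_add] at h
    refine h.congr fun N => ?_
    have hN : (2 * (N : ℝ) + 1) ≠ 0 := by positivity
    field_simp
    ring
  have h := (hratio.mul hab).add (tendsto_inv_mul_of_abs_le (abs_symmSum_sub_le hf))
  unfold HasMean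
  rw [show (a + b) / 2 = 1 / 2 * (a + b) + 0 by ring]
  refine h.congr fun N => ?_
  have hN : (2 * (N : ℝ) + 1) ≠ 0 := by positivity
  have hM : (2 * ((N / 2 : ℕ) : ℝ) + 1) ≠ 0 := by positivity
  simp only [Function.comp_apply]
  field_simp
  ring

theorem symmSum_comp_add_one (f : ℤ → ℝ) (N : ℕ) :
    symmSum (fun i => f (i + 1)) N = symmSum f N + (f (N + 1) - f (-N)) := by
  induction N with
  | zero => simp [symmSum_zero]
  | succ N ih =>
    rw [symmSum_succ, symmSum_succ, ih]
    push_cast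
    rw [show -((N : ℤ) + 1) + 1 = -N by ring]
    ring

theorem hasMean_comp_add_one_iff {f : ℤ → ℝ} {c : ℝ} (hf : ∀ i, |f i| ≤ 1) :
    HasMean (fun i => f (i + 1)) c ↔ HasMean f c := by
  have hd : ∀ N : ℕ, |f (N + 1) - f (-N)| ≤ 2 := fun N => by
    refine (abs_sub _ _).trans ?_
    linarith [hf (N + 1), hf (-N)]
  have h := tendsto_inv_mul_of_abs_le hd
  constructor <;> intro hm
  · have := hm.sub h
    rw [sub_zero] at this
    refine this.congr fun N => ?_
    rw [symmSum_comp_add_one]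
    ring
  · have := hm.add h
    rw [add_zero] at this
    refine this.congr fun N => ?_
    rw [symmSum_comp_add_one]
    ring

theorem HasMean.comp_add {f : ℤ → ℝ} {c : ℝ} (hf : ∀ i, |f i| ≤ 1) (h : HasMean f c) (K : ℤ) :
    HasMean (fun i => f (i + K)) c := by
  induction K using Int.induction_on with
  | zero => simpa using h
  | succ k ih =>
    have := (hasMean_comp_add_one_iff (f := fun i => f (i + k)) fun i => hf _).2 ih
    simpa only [add_assoc, add_comm (1 : ℤ)] using this
  | pred k ih =>
    refine (hasMean_comp_add_one_iff (f := fun i => f (i + (-(k : ℤ) - 1))) fun i => hf _).1 ?_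
    convert ih using 3
    ring

theorem hasMean_zero_of_log {f : ℤ → ℝ} {C : ℝ}
    (h : ∀ N : ℕ, |symmSum f N| ≤ C * (Nat.log 2 N + 1)) : HasMean f 0 := by
  have hlog : Filter.Tendsto (fun N : ℕ => 1 / (2 * (N : ℝ) + 1) * Nat.log 2 N)
      Filter.atTop (nhds 0) := by
    have h1 : Filter.Tendsto (fun N : ℕ => Real.log N / N) Filter.atTop (nhds 0) :=
      (Real.isLittleO_log_id_atTop.tendsto_div_nhds_zero).comp tendsto_natCast_atTop_atTop
    have h2 := h1.mul_const (1 / Real.log 2)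
    rw [zero_mul] at h2
    refine squeeze_zero' (Filter.Eventually.of_forall fun N => by positivity) ?_ h2
    filter_upwards [Filter.eventually_gt_atTop 0] with N hN
    have hN' : (0 : ℝ) < N := by exact_mod_cast hN
    have hl : (Nat.log 2 N : ℝ) ≤ Real.log N / Real.log 2 := by
      simpa [Real.logb] using Real.natLog_le_logb N 2
    calc 1 / (2 * (N : ℝ) + 1) * Nat.log 2 N
        ≤ 1 / (N : ℝ) * (Real.log N / Real.log 2) := by
          gcongr
          linarith
      _ = Real.log N / N * (1 / Real.log 2) := by ring
  have hb := (hlog.add tendsto_inv_two_mul_add_one).const_mul C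
  rw [add_zero, mul_zero] at hb
  refine squeeze_zero_norm (fun N => ?_) hb
  have hN : (0 : ℝ) < 1 / (2 * (N : ℝ) + 1) := by positivity
  rw [Real.norm_eq_abs, abs_mul, abs_of_pos hN]
  refine (mul_le_mul_of_nonneg_left (h N) hN.le).trans (le_of_eq ?_)
  ring

/-! ### The alternating sign -/

/-- The alternating sequence `(-1) ^ i`. -/
noncomputable def altSign (i : ℤ) : ℝ := (-1 : ℝ) ^ i

theorem altSign_add (i j : ℤ) : altSign (i + j) = altSign i * altSign j :=
  zpow_add₀ (by norm_num) i j

theorem altSign_one : altSign 1 = -1 := by simp [altSign]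

theorem altSign_mul_self (i : ℤ) : altSign i * altSign i = 1 := by
  rw [← altSign_add]
  exact Even.neg_one_zpow ⟨i, rfl⟩

theorem altSign_two_mul (i : ℤ) : altSign (2 * i) = 1 := by
  rw [two_mul, altSign_add, altSign_mul_self]

theorem altSign_two_mul_add_one (i : ℤ) : altSign (2 * i + 1) = -1 := by
  rw [altSign_add, altSign_two_mul, altSign_one, one_mul]

theorem abs_eq_one_of_mul_self {x : ℝ} (h : x * x = 1) : |x| = 1 := by
  rcases mul_self_eq_one_iff.mp h with h | h <;> simp [h]

theorem abs_altSign (i : ℤ) : |altSign i| = 1 := abs_eq_one_of_mul_self (altSign_mul_self i)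

theorem hasMean_altSign : HasMean altSign 0 := by
  have h := HasMean.of_halves (f := altSign) (a := 1) (b := -1) (fun i => (abs_altSign i).le)
    (by simpa only [altSign_two_mul] using hasMean_const 1)
    (by simpa only [altSign_two_mul_add_one] using hasMean_const (-1))
  simpa using h

theorem abs_symmSum_altSign_le (N : ℕ) : |symmSum altSign N| ≤ 1 := by
  have h := abs_symmSum_sub_le (fun i => (abs_altSign i).le) N
  simp only [altSign_two_mul, altSign_two_mul_add_one] at h
  simpa [symmSum] using h

/-! ### Pairs of sequences related by the Rudin–Shapiro substitution -/

/-- `w` arises from `v` by the binary Rudin–Shapiro recursion. -/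
structure IsRSImage (w v : ℤ → ℝ) : Prop where
  even : ∀ i, w (2 * i) = v i
  odd : ∀ i, w (2 * i + 1) = altSign i * v i

/-- Two sign sequences which are exchanged by the binary Rudin–Shapiro recursion. -/
structure IsRSPair (w v : ℤ → ℝ) : Prop where
  left : IsRSImage w v
  right : IsRSImage v w
  mul_self_left : ∀ i, w i * w i = 1
  mul_self_right : ∀ i, v i * v i = 1

theorem IsRSPair.symm {w v : ℤ → ℝ} (h : IsRSPair w v) : IsRSPair v w :=
  ⟨h.right, h.left, h.mul_self_right, h.mul_self_left⟩

theorem rsWeight_mul_self (a : Fin 4) : rsWeight a * rsWeight a = 1 := by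
  fin_cases a <;> simp [rsWeight]

theorem rsWeight_rsSubst_fst (a : Fin 4) : rsWeight (rsSubst a).1 = rsWeight a := by
  fin_cases a <;> simp [rsWeight, rsSubst]

theorem rsSubstWord_two_mul (u : ℤ → Fin 4) (i : ℤ) :
    rsSubstWord u (2 * i) = (rsSubst (u i)).1 := by
  simp [rsSubstWord]

theorem rsSubstWord_two_mul_add_one (u : ℤ → Fin 4) (i : ℤ) :
    rsSubstWord u (2 * i + 1) = (rsSubst (u i)).2 := by
  have h : (2 * i + 1) / 2 = i := by omega
  simp [rsSubstWord, h]

/-- In a substituted word even positions carry only 0 or 3, whose images end in a letter of the same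
weight; odd positions carry only 1 or 2, where the weight flips. -/
theorem rsWeight_rsSubst_snd (u : ℤ → Fin 4) (i : ℤ) :
    rsWeight (rsSubst (rsSubstWord u i)).2 = altSign i * rsWeight (rsSubstWord u i) := by
  rcases Int.even_or_odd' i with ⟨j, rfl | rfl⟩
  · rw [rsSubstWord_two_mul, altSign_two_mul]
    generalize u j = a
    fin_cases a <;> simp [rsWeight, rsSubst]
  · rw [rsSubstWord_two_mul_add_one, altSign_two_mul_add_one]
    generalize u j = a
    fin_cases a <;> simp [rsWeight, rsSubst]

theorem isRSImage_of_rsSubstWord (u : ℤ → Fin 4) :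
    IsRSImage (fun i => rsWeight (rsSubstWord (rsSubstWord u) i))
      (fun i => rsWeight (rsSubstWord u i)) where
  even i := by rw [rsSubstWord_two_mul, rsWeight_rsSubst_fst]
  odd i := by rw [rsSubstWord_two_mul_add_one, rsWeight_rsSubst_snd]

theorem IsBinaryRS.exists_isRSPair {w : ℤ → ℝ} (hw : IsBinaryRS w) : ∃ v, IsRSPair w v := by
  obtain ⟨u, hu, hwu⟩ := hw
  obtain rfl : w = fun i => rsWeight (u i) := funext hwu
  refine ⟨fun i => rsWeight (rsSubstWord u i), ?_, ?_, fun i => rsWeight_mul_self _,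
    fun i => rsWeight_mul_self _⟩
  · simpa only [hu.fixed] using isRSImage_of_rsSubstWord u
  · simpa only [hu.fixed] using isRSImage_of_rsSubstWord (rsSubstWord u)

namespace IsRSPair

variable {w v : ℤ → ℝ}

theorem abs_left (h : IsRSPair w v) (i : ℤ) : |w i| = 1 :=
  abs_eq_one_of_mul_self (h.mul_self_left i)

/-! ### Two-point correlations -/

/-- The splitting gives only θ(1) = -θ(1)/2, which determines the limit but does not show that it
exists. A bound on the sums does: each halving of `N` costs a bounded error, so they grow at most
logarithmically. -/
theorem abs_symmSum_theta_one_le (N : ℕ) : ∀ {w v : ℤ → ℝ}, IsRSPair w v →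
    |symmSum (fun i => altSign i * (w i * w (i + 1))) N| ≤ 3 * (Nat.log 2 N + 1) := by
  induction N using Nat.strong_induction_on with
  | _ N ih =>
    intro w v h
    have hb : ∀ i, |altSign i * (w i * w (i + 1))| ≤ 1 := fun i => by
      simp [abs_mul, abs_altSign, h.abs_left]
    rcases Nat.lt_or_ge N 2 with hN | hN
    · have hl : (0 : ℝ) ≤ Nat.log 2 N := Nat.cast_nonneg _
      have h3 : |symmSum (fun i => altSign i * (w i * w (i + 1))) N| ≤ 3 := by
        interval_cases N
        · rw [symmSum_zero]
          exact (hb 0).trans (by norm_num)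
        · have h1 := symmSum_succ (fun i => altSign i * (w i * w (i + 1))) 0
          rw [symmSum_zero, zero_add] at h1
          rw [h1]
          refine (abs_add_three _ _ _).trans ?_
          linarith [hb 0, hb ((0 : ℕ) + 1), hb (-((0 : ℕ) + 1))]
      linarith
    · have hs := abs_symmSum_sub_le hb N
      have e0 : (fun i : ℤ => altSign (2 * i) * (w (2 * i) * w (2 * i + 1))) = altSign := by
        funext i
        rw [altSign_two_mul, h.left.even, h.left.odd]
        linear_combination altSign i * h.mul_self_right i
      have e1 : (fun i : ℤ => altSign (2 * i + 1) * (w (2 * i + 1) * w (2 * i + 1 + 1))) =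
          fun i => -(altSign i * (v i * v (i + 1))) := by
        funext i
        rw [show 2 * i + 1 + 1 = 2 * (i + 1) by ring, altSign_two_mul_add_one, h.left.even,
          h.left.odd]
        ring
      rw [e0, e1] at hs
      -- One unit of error from the alternating sum and one from the boundary term fit into the
      -- constant 3, which the three-term sum at `N = 1` requires.
      have h1 := abs_symmSum_altSign_le (N / 2)
      have h2 := ih (N / 2) (by omega) h.symm
      have hl : Nat.log 2 N = Nat.log 2 (N / 2) + 1 := Nat.log_of_one_lt_of_le one_lt_two hN
      have hneg : symmSum (fun i => -(altSign i * (v i * v (i + 1)))) (N / 2) =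
          -symmSum (fun i => altSign i * (v i * v (i + 1))) (N / 2) := by
        simp [symmSum]
      rw [hneg] at hs
      rw [hl]
      push_cast
      rw [abs_le] at *
      constructor <;> linarith

theorem hasMean_theta_one (h : IsRSPair w v) :
    HasMean (fun i => altSign i * (w i * w (i + 1))) 0 :=
  hasMean_zero_of_log fun N => abs_symmSum_theta_one_le N h

theorem hasMean_theta_one_comp_add (h : IsRSPair w v) (K : ℤ) :
    HasMean (fun i => altSign (i + K) * (w (i + K) * w (i + K + 1))) 0 :=
  h.hasMean_theta_one.comp_add (fun i => by simp [abs_mul, abs_altSign, h.abs_left]) K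

theorem hasMean_eta_one (h : IsRSPair w v) : HasMean (fun i => w i * w (i + 1)) 0 := by
  have e0 : (fun i : ℤ => w (2 * i) * w (2 * i + 1)) = altSign := by
    funext i
    rw [h.left.even, h.left.odd]
    linear_combination altSign i * h.mul_self_right i
  have e1 : (fun i : ℤ => w (2 * i + 1) * w (2 * i + 1 + 1)) =
      fun i => altSign i * (v i * v (i + 1)) := by
    funext i
    rw [show 2 * i + 1 + 1 = 2 * (i + 1) by ring, h.left.even, h.left.odd]
    ring
  have := HasMean.of_halves (f := fun i => w i * w (i + 1)) (a := 0) (b := 0)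
    (fun i => by simp [abs_mul, h.abs_left]) (by rw [e0]; exact hasMean_altSign)
    (by rw [e1]; exact h.symm.hasMean_theta_one)
  simpa using this

theorem hasMean_eta_one_comp_add (h : IsRSPair w v) (K : ℤ) :
    HasMean (fun i => w (i + K) * w (i + K + 1)) 0 :=
  h.hasMean_eta_one.comp_add (fun i => by simp [abs_mul, h.abs_left]) K

end IsRSPair

/-! ### Four-point correlations -/

/-- The four-fold product whose means are the four-point correlations. -/
def fourProd (w : ℤ → ℝ) (a b c i : ℤ) : ℝ := w i * (w (i + a) * w (i + b) * w (i + c))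

theorem hasEta_iff (w : ℤ → ℝ) (r a b c : ℤ) (x : ℝ) :
    HasEta w (r • ![a, b, c]) x ↔ HasMean (fourProd w (r * a) (r * b) (r * c)) x := by
  have : (fun i => w i * ∏ j, w (i + (r • ![a, b, c]) j)) =
      fourProd w (r * a) (r * b) (r * c) := by
    funext i
    simp [fourProd, Fin.prod_univ_three]
  rw [← this]
  rfl

theorem hasTheta_iff (w : ℤ → ℝ) (r a b c : ℤ) (x : ℝ) :
    HasTheta w (r • ![a, b, c]) x ↔
      HasMean (fun i => altSign i * fourProd w (r * a) (r * b) (r * c) i) x := by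
  have : (fun i => altSign i * (w i * ∏ j, w (i + (r • ![a, b, c]) j))) =
      fun i => altSign i * fourProd w (r * a) (r * b) (r * c) i := by
    funext i
    simp [fourProd, Fin.prod_univ_three]
  rw [← this]
  rfl

namespace IsRSPair

variable {w v : ℤ → ℝ}

theorem abs_fourProd (h : IsRSPair w v) (a b c i : ℤ) : |fourProd w a b c i| = 1 := by
  simp [fourProd, abs_mul, h.abs_left]

/-- The means of the halves of a four-fold product determine its two correlations. -/
theorem hasMean_fourProd_of_halves (h : IsRSPair w v) {a b c : ℤ} {x y : ℝ}
    (h0 : HasMean (fun i => fourProd w a b c (2 * i)) x)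
    (h1 : HasMean (fun i => fourProd w a b c (2 * i + 1)) y) :
    HasMean (fourProd w a b c) ((x + y) / 2) ∧
      HasMean (fun i => altSign i * fourProd w a b c i) ((x - y) / 2) := by
  refine ⟨HasMean.of_halves (fun i => (h.abs_fourProd a b c i).le) h0 h1, ?_⟩
  rw [sub_eq_add_neg]
  refine HasMean.of_halves (fun i => ?_) ?_ ?_
  · rw [abs_mul, abs_altSign, h.abs_fourProd, one_mul]
  · simpa only [altSign_two_mul, one_mul] using h0
  · simpa only [altSign_two_mul_add_one, neg_one_mul] using h1.const_mul (-1)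

/-- At odd positions the four factors `altSign i` cancel, so the two halves differ only by the sign
of `a + b + c`. -/
theorem hasMean_fourProd_two_mul (h : IsRSPair w v) {a b c : ℤ} {x : ℝ}
    (hx : HasMean (fourProd v a b c) x) :
    HasMean (fourProd w (2 * a) (2 * b) (2 * c)) ((x + altSign (a + b + c) * x) / 2) ∧
      HasMean (fun i => altSign i * fourProd w (2 * a) (2 * b) (2 * c) i)
        ((x - altSign (a + b + c) * x) / 2) := by
  refine h.hasMean_fourProd_of_halves ?_ ?_
  · convert hx using 2 with i
    simp only [fourProd, ← mul_add, h.left.even]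
  · convert hx.const_mul (altSign (a + b + c)) using 2 with i
    have e : ∀ d, 2 * i + 1 + 2 * d = 2 * (i + d) + 1 := fun d => by ring
    simp only [fourProd, e, h.left.odd, altSign_add]
    linear_combination (altSign a * altSign b * altSign c *
      (v i * (v (i + a) * v (i + b) * v (i + c)))) *
      (altSign i * altSign i + 1) * altSign_mul_self i

/-- The sign `hs` matters only at the first doubling; afterwards η is already zero. -/
theorem hasMean_fourProd_two_pow_mul {a b c : ℤ} {x y : ℝ} (hs : altSign (a + b + c) = -1)
    (hx : ∀ {w v : ℤ → ℝ}, IsRSPair w v → HasMean (fourProd w a b c) x ∧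
      HasMean (fun i => altSign i * fourProd w a b c i) y) (m : ℕ) :
    ∀ {w v : ℤ → ℝ}, IsRSPair w v →
    HasMean (fourProd w (2 ^ m * a) (2 ^ m * b) (2 ^ m * c)) (if m = 0 then x else 0) ∧
      HasMean (fun i => altSign i * fourProd w (2 ^ m * a) (2 ^ m * b) (2 ^ m * c) i)
        (if m = 0 then y else if m = 1 then x else 0) := by
  induction m with
  | zero =>
    intro w v h
    simpa using hx h
  | succ m ih =>
    intro w v h
    have h2 := h.hasMean_fourProd_two_mul (ih h.symm).1
    simp only [pow_succ', mul_assoc]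
    rcases m with _ | m
    · simpa [hs] using h2
    · simpa using h2

/-! ### The correlations of `(1, K, K + 1)` -/

/-- In each half two factors share an argument and square to 1, leaving a multiple of a neighbour
correlation of mean zero. -/
theorem hasMean_fourProd_odd (h : IsRSPair w v) (J : ℤ) :
    HasMean (fourProd w 1 (2 * J + 1) (2 * J + 1 + 1)) 0 ∧
      HasMean (fun i => altSign i * fourProd w 1 (2 * J + 1) (2 * J + 1 + 1) i) 0 := by
  have e0 : (fun i => fourProd w 1 (2 * J + 1) (2 * J + 1 + 1) (2 * i)) =
      fun i => altSign J * (v (i + J) * v (i + J + 1)) := by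
    funext i
    rw [fourProd, show 2 * i + (2 * J + 1) = 2 * (i + J) + 1 by ring,
      show 2 * i + (2 * J + 1 + 1) = 2 * (i + J + 1) by ring]
    simp only [h.left.odd, h.left.even, altSign_add]
    linear_combination (altSign i * altSign i * altSign J * v (i + J) * v (i + J + 1)) *
      h.mul_self_right i + (altSign J * v (i + J) * v (i + J + 1)) * altSign_mul_self i
  have e1 : (fun i => fourProd w 1 (2 * J + 1) (2 * J + 1 + 1) (2 * i + 1)) =
      fun i => -altSign J * (v i * v (i + 1)) := by
    funext i
    rw [fourProd, show 2 * i + 1 + 1 = 2 * (i + 1) by ring,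
      show 2 * i + 1 + (2 * J + 1) = 2 * (i + J + 1) by ring,
      show 2 * i + 1 + (2 * J + 1 + 1) = 2 * (i + J + 1) + 1 by ring]
    simp only [h.left.odd, h.left.even, altSign_add, altSign_one]
    linear_combination (-(altSign i * altSign i * altSign J * v i * v (i + 1))) *
      h.mul_self_right (i + J + 1) - (altSign J * v i * v (i + 1)) * altSign_mul_self i
  have := h.hasMean_fourProd_of_halves (a := 1) (b := 2 * J + 1) (c := 2 * J + 1 + 1)
    (by rw [e0]; exact (h.symm.hasMean_eta_one_comp_add J).const_mul _)
    (by rw [e1]; exact h.symm.hasMean_eta_one.const_mul _)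
  simpa using this

/-- The even half is constant, its factors cancelling in pairs; the odd half reproduces the product
at `J`. -/
theorem hasMean_fourProd_even (h : IsRSPair w v) {J : ℤ} {x : ℝ}
    (hx : HasMean (fourProd v 1 J (J + 1)) x) :
    HasMean (fourProd w 1 (2 * J) (2 * J + 1)) (altSign J * ((1 + x) / 2)) ∧
      HasMean (fun i => altSign i * fourProd w 1 (2 * J) (2 * J + 1) i)
        (altSign J * ((1 - x) / 2)) := by
  have e0 : (fun i => fourProd w 1 (2 * J) (2 * J + 1) (2 * i)) = fun _ => altSign J := by
    funext i
    rw [fourProd, show 2 * i + 2 * J = 2 * (i + J) by ring,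
      show 2 * i + (2 * J + 1) = 2 * (i + J) + 1 by ring]
    simp only [h.left.odd, h.left.even, altSign_add]
    linear_combination (altSign i * altSign i * altSign J * v (i + J) * v (i + J)) *
      h.mul_self_right i + (altSign i * altSign i * altSign J) * h.mul_self_right (i + J) +
      altSign J * altSign_mul_self i
  have e1 : (fun i => fourProd w 1 (2 * J) (2 * J + 1) (2 * i + 1)) =
      fun i => altSign J * fourProd v 1 J (J + 1) i := by
    funext i
    rw [fourProd, fourProd, show 2 * i + 1 + 1 = 2 * (i + 1) by ring,
      show 2 * i + 1 + 2 * J = 2 * (i + J) + 1 by ring,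
      show 2 * i + 1 + (2 * J + 1) = 2 * (i + (J + 1)) by ring]
    simp only [h.left.odd, h.left.even, altSign_add]
    linear_combination (altSign J * (v i * (v (i + 1) * v (i + J) * v (i + (J + 1))))) *
      altSign_mul_self i
  have := h.hasMean_fourProd_of_halves (a := 1) (b := 2 * J) (c := 2 * J + 1)
    (by rw [e0]; exact hasMean_const _) (by rw [e1]; exact hx.const_mul _)
  convert this using 2 <;> ring

theorem hasMean_fourProd_two_pow (l : ℤ) (k : ℕ) : ∀ {w v : ℤ → ℝ}, IsRSPair w v →
    HasMean (fourProd w 1 (2 ^ k * (2 * l + 1)) (2 ^ k * (2 * l + 1) + 1))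
        (if k = 0 then 0 else 1 - 3 / 2 ^ k) ∧
      HasMean (fun i => altSign i *
          fourProd w 1 (2 ^ k * (2 * l + 1)) (2 ^ k * (2 * l + 1) + 1) i)
        (if k = 0 then 0 else if k = 1 then -(1 / 2) else 3 / 2 ^ k) := by
  induction k with
  | zero =>
    intro w v h
    simpa using h.hasMean_fourProd_odd l
  | succ k ih =>
    intro w v h
    have h2 := h.hasMean_fourProd_even (ih h.symm).1
    rw [pow_succ', mul_assoc]
    convert h2 using 2
    all_goals
      -- Only the first step has odd `J`, hence the negative sign; this is why θ is exceptional at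
      -- `k = 1`.
      rcases k with _ | k
      · rw [pow_zero, one_mul, altSign_two_mul_add_one]
        norm_num
      · rw [pow_succ' 2 k, mul_assoc 2 (2 ^ k), altSign_two_mul]
        simp
        field_simp
        ring

/-! ### The correlations of `(1, L, L + 2)` and `(1, L - 1, L + 1)` -/

/-- The even half is a signed neighbour correlation of mean zero. Three signs survive in the odd
half, with product `-altSign i`, so only θ of `v` enters. -/
theorem hasMean_fourProd_add_two (h : IsRSPair w v) {K : ℤ} {t : ℝ}
    (ht : HasMean (fun i => altSign i * fourProd v 1 K (K + 1) i) t) :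
    HasMean (fourProd w 1 (2 * K) (2 * K + 2)) (-(t / 2)) ∧
      HasMean (fun i => altSign i * fourProd w 1 (2 * K) (2 * K + 2) i) (t / 2) := by
  have e0 : (fun i => fourProd w 1 (2 * K) (2 * K + 2) (2 * i)) =
      fun i => altSign K * (altSign (i + K) * (v (i + K) * v (i + K + 1))) := by
    funext i
    rw [fourProd, show 2 * i + 2 * K = 2 * (i + K) by ring,
      show 2 * i + (2 * K + 2) = 2 * (i + K + 1) by ring]
    simp only [h.left.odd, h.left.even, altSign_add]
    linear_combination (altSign i * v (i + K) * v (i + K + 1)) *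
      (h.mul_self_right i - altSign_mul_self K)
  have e1 : (fun i => fourProd w 1 (2 * K) (2 * K + 2) (2 * i + 1)) =
      fun i => -1 * (altSign i * fourProd v 1 K (K + 1) i) := by
    funext i
    rw [fourProd, fourProd, show 2 * i + 1 + 1 = 2 * (i + 1) by ring,
      show 2 * i + 1 + 2 * K = 2 * (i + K) + 1 by ring,
      show 2 * i + 1 + (2 * K + 2) = 2 * (i + (K + 1)) + 1 by ring]
    simp only [h.left.odd, h.left.even, altSign_add, altSign_one]
    linear_combination (-(altSign i * (v i * (v (i + 1) * v (i + K) * v (i + (K + 1)))))) *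
      (altSign K * altSign K * altSign_mul_self i + altSign_mul_self K)
  have := h.hasMean_fourProd_of_halves (a := 1) (b := 2 * K) (c := 2 * K + 2)
    (by rw [e0]; exact (h.symm.hasMean_theta_one_comp_add K).const_mul _)
    (by rw [e1]; exact ht.const_mul _)
  convert this using 2 <;> ring

/-- Here only one argument in the odd half is odd, so its sign is `altSign i` and the values are
opposite to those of `hasMean_fourProd_add_two`. -/
theorem hasMean_fourProd_sub_one_add_one (h : IsRSPair w v) {K : ℤ} {t : ℝ}
    (ht : HasMean (fun i => altSign i * fourProd v 1 K (K + 1) i) t) :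
    HasMean (fourProd w 1 (2 * K - 1) (2 * K + 1)) (t / 2) ∧
      HasMean (fun i => altSign i * fourProd w 1 (2 * K - 1) (2 * K + 1) i) (-(t / 2)) := by
  obtain ⟨M, rfl⟩ : ∃ M, K = M + 1 := ⟨K - 1, by ring⟩
  have e0 : (fun i => fourProd w 1 (2 * (M + 1) - 1) (2 * (M + 1) + 1) (2 * i)) =
      fun i => -altSign M * (altSign (i + M) * (v (i + M) * v (i + M + 1))) := by
    funext i
    rw [fourProd, show 2 * i + (2 * (M + 1) - 1) = 2 * (i + M) + 1 by ring,
      show 2 * i + (2 * (M + 1) + 1) = 2 * (i + M + 1) + 1 by ring]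
    simp only [h.left.odd, h.left.even, altSign_add, altSign_one]
    linear_combination (-(altSign i * altSign M * altSign M * v (i + M) * v (i + M + 1))) *
      (altSign i * altSign i * h.mul_self_right i + altSign_mul_self i)
  have e1 : (fun i => fourProd w 1 (2 * (M + 1) - 1) (2 * (M + 1) + 1) (2 * i + 1)) =
      fun i => altSign i * fourProd v 1 (M + 1) (M + 1 + 1) i := by
    funext i
    rw [fourProd, fourProd, show 2 * i + 1 + 1 = 2 * (i + 1) by ring,
      show 2 * i + 1 + (2 * (M + 1) - 1) = 2 * (i + (M + 1)) by ring,
      show 2 * i + 1 + (2 * (M + 1) + 1) = 2 * (i + (M + 1 + 1)) by ring]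
    simp only [h.left.odd, h.left.even]
    ring
  have := h.hasMean_fourProd_of_halves (a := 1) (b := 2 * (M + 1) - 1) (c := 2 * (M + 1) + 1)
    (by rw [e0]; exact (h.symm.hasMean_theta_one_comp_add M).const_mul _)
    (by rw [e1]; exact ht)
  convert this using 2 <;> ring

end IsRSPair

theorem mainTheorem9 (w : ℤ → ℝ) (hw : IsBinaryRS w) (l : ℤ) (m n : ℕ) (hn : 1 ≤ n) :
    HasEta w ((2 : ℤ) ^ m • ![1, 2 ^ n * (2 * l + 1), 2 ^ n * (2 * l + 1) + 2])
      (if m = 0 then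
        (if n = 1 then 0 else if n = 2 then 1 / 4 else -(3 / 2 ^ n))
      else 0) ∧
    HasTheta w ((2 : ℤ) ^ m • ![1, 2 ^ n * (2 * l + 1), 2 ^ n * (2 * l + 1) + 2])
      (if m = 0 ∨ m = 1 then
        (if n = 1 then 0 else if n = 2 then -((-1) ^ m * (1 / 4)) else (-1) ^ m * (3 / 2 ^ n))
      else 0) ∧
    HasEta w ((2 : ℤ) ^ m • ![1, 2 ^ n * (2 * l + 1) - 1, 2 ^ n * (2 * l + 1) + 1])
      (if m = 0 then
        (if n = 1 then 0 else if n = 2 then -(1 / 4) else 3 / 2 ^ n)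
      else 0) ∧
    HasTheta w ((2 : ℤ) ^ m • ![1, 2 ^ n * (2 * l + 1) - 1, 2 ^ n * (2 * l + 1) + 1])
      (if m = 0 ∨ m = 1 then
        (if n = 1 then 0 else if n = 2 then (-1) ^ m * (1 / 4) else -((-1) ^ m * (3 / 2 ^ n)))
      else 0) := by
  obtain ⟨v, h⟩ := hw.exists_isRSPair
  obtain ⟨k, rfl⟩ : ∃ k, n = k + 1 := ⟨n - 1, by omega⟩
  have hL : (2 : ℤ) ^ (k + 1) * (2 * l + 1) = 2 * (2 ^ k * (2 * l + 1)) := by ring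
  rw [hL]
  have hA := IsRSPair.hasMean_fourProd_two_pow_mul
    (by rw [← altSign_two_mul_add_one (2 * (2 ^ k * (2 * l + 1)) + 1)]; congr 1; ring)
    (fun {_ _} h => h.hasMean_fourProd_add_two
      (IsRSPair.hasMean_fourProd_two_pow l k h.symm).2) m h
  have hB := IsRSPair.hasMean_fourProd_two_pow_mul
    (by rw [← altSign_two_mul_add_one (2 * (2 ^ k * (2 * l + 1)))]; congr 1; ring)
    (fun {_ _} h => h.hasMean_fourProd_sub_one_add_one
      (IsRSPair.hasMean_fourProd_two_pow l k h.symm).2) m h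
  have hne : ∀ j : ℕ, j + 1 + 1 + 1 ≠ 2 := fun j => by omega
  have hpow : (3 : ℝ) / 2 ^ (k + 1) = 3 / 2 ^ k / 2 := by
    rw [pow_succ, div_mul_eq_div_div]
  rw [hasEta_iff, hasTheta_iff, hasEta_iff, hasTheta_iff, hpow]
  refine ⟨?_, ?_, ?_, ?_⟩
  · convert hA.1 using 1
    rcases k with _ | _ | k <;> rcases m with _ | _ | m <;> norm_num [hne]
  · convert hA.2 using 1
    rcases k with _ | _ | k <;> rcases m with _ | _ | m <;> norm_num [hne]
  · convert hB.1 using 1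
    rcases k with _ | _ | k <;> rcases m with _ | _ | m <;> norm_num [hne]
  · convert hB.2 using 1
    rcases k with _ | _ | k <;> rcases m with _ | _ | m <;> norm_num [hne]
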